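/- Let $V=\{v_1<v_2<\dots<v_n\}$ be a finite set of positive real values. A market is a vector $\mathbf x\in\mathbb R_{\ge 0}^n$, where $x_i$ is the mass of buyers with value $v_i$. For $p\in V$ let $R_{\mathbf x}(p)=p\sum_{i:v_i\ge p}x_i$ be the revenue at price $p$, let $\mathrm{Opt}(\mathbf x)=\arg\max_{p\in V}R_{\mathbf x}(p)$, and let $R_{\mathrm{uniform}}(\mathbf x)=\max_{p\in V}R_{\mathbf x}(p)$. A market scheme for a market $\mathbf x^*$ is a finite collection $\mathcal Z=\{(\mathbf x_q,p_q)\}_{q\in[Q]}$ with $\mathbf x_q\in\mathbb R_{\ge 0}^n$, $p_q\in V$ and $\sum_q\mathbf x_q=\mathbf x^*$. Its consumer surplus and producer surplus are $$\mathrm{CS}(\mathcal Z)=\sum_q\sum_{i:v_i\ge p_q}(v_i-p_q)\,x_{q,i},\qquad \mathrm{PS}(\mathcal Z)=\sum_q\sum_{i:v_i\ge p_q}p_q\,x_{q,i}.$$ For $F\subseteq V$, the scheme is $F$-valid if $p_q\in F\cap\mathrm{Opt}(\mathbf x_q)$ for all $q$, and $F$ is $\mathbf x^*$-feasible if there is an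 $F$-valid market scheme for $\mathbf x^*$. Let $\mathbf x^*$ be a market and let $F=\{v_\ell,v_{\ell+1},\dots,v_r\}$, $\ell\le r$, be an $\mathbf x^*$-feasible contiguous price set. Let $$i_0=\max\{i\in\{\ell,\dots,r\}:\{v_i,\dots,v_r\}\text{ is }\mathbf x^*\text{-feasible}\},$$ and let $\eta_0$ be the infimum of all $\eta\in[0,x^*_{i_0}]$ for which there is an $F$-valid market scheme $\{(\mathbf x_q,p_q)\}_{q\in[Q]}$ for $\mathbf x^*$ with $p_q\in\{v_{i_0},\dots,v_r\}$ for all $q$ and $\sum_{q:\,p_q=v_{i_0}}x_{q,i_0}\le\eta$. Then the minimum $\mathrm{CS}_P^{\min}(\mathbf x^*,F)$ of $\mathrm{CS}(\mathcal Z)$ over all $F$-valid market schemes $\mathcal Z$ for $\mathbf x^*$ exists, and there is an $F$-valid market scheme $\mathcal Z_{\mathrm{PMin}}$ for $\mathbf x^*$ such that $$\mathrm{CS}(\mathcal Z_{\mathrm{PMin}})=\mathrm{CS}_P^{\min}(\mathbf x^*,F),\qquad \mathrm{PS}(\mathcal Z_{\mathrm{PMin}})=R_{\mathrm{uniform}}(\mathbf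 x^*).$$ Furthermore, $$\mathrm{CS}_P^{\min}(\mathbf x^*,F)=\eta_0v_{i_0}+\sum_{j=i_0+1}^n x^*_jv_j-R_{\mathrm{uniform}}(\mathbf x^*).$$ -/

import Mathlib

namespace PriceRegulation

/-! The values are `v 0 < v 1 < ... < v (n-1)`, given by a strictly increasing `v : Fin n → ℝ`.
A market is a nonnegative vector `x : Fin n → ℝ`, where `x i` is the mass of buyers of value `v i`.
A price in `V = {v i}` is represented by its index, and a price set `F ⊆ V` by the finset of the
indices of its elements; the contiguous set `{v ℓ, ..., v r}` is `Finset.Icc ℓ r`. -/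

/-- The cumulative demand at price `v p`: the mass of buyers of value at least `v p`. -/
noncomputable def demand {n : ℕ} (v x : Fin n → ℝ) (p : Fin n) : ℝ :=
  ∑ i with v p ≤ v i, x i

/-- The revenue from posting price `v p` in the market `x`. -/
noncomputable def revenue {n : ℕ} (v x : Fin n → ℝ) (p : Fin n) : ℝ :=
  v p * demand v x p

/-- The price `v p` is revenue-maximizing in the market `x`, among all prices in `V`. -/
def IsOptPrice {n : ℕ} (v x : Fin n → ℝ) (p : Fin n) : Prop :=
  ∀ p' : Fin n, revenue v x p' ≤ revenue v x p

/-- The maximal revenue of a single posted price; for `n ≥ 1` it is a maximum over the nonempty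
finite set of prices. -/
noncomputable def uniformRevenue {n : ℕ} (v x : Fin n → ℝ) : ℝ :=
  ⨆ p : Fin n, revenue v x p

/-- A market scheme for the aggregate market `xstar`: finitely many market segments adding up to
`xstar`, each with an instructed price. -/
structure MarketScheme {n : ℕ} (xstar : Fin n → ℝ) where
  /-- the number of segments -/
  Q : ℕ
  /-- the segments -/
  seg : Fin Q → Fin n → ℝ
  /-- the index of the instructed price of each segment -/
  price : Fin Q → Fin n
  seg_nonneg : ∀ q i, 0 ≤ seg q i
  sum_seg : ∀ i, ∑ q, seg q i = xstar i

/-- The consumer surplus of the market `x` at price `v p`. -/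
noncomputable def cs {n : ℕ} (v x : Fin n → ℝ) (p : Fin n) : ℝ :=
  ∑ i with v p ≤ v i, (v i - v p) * x i

/-- The producer surplus of the market `x` at price `v p`. -/
noncomputable def ps {n : ℕ} (v x : Fin n → ℝ) (p : Fin n) : ℝ :=
  ∑ i with v p ≤ v i, v p * x i

/-- The consumer surplus of a market scheme. -/
noncomputable def MarketScheme.CS {n : ℕ} {xstar : Fin n → ℝ} (v : Fin n → ℝ)
    (Z : MarketScheme xstar) : ℝ :=
  ∑ q, cs v (Z.seg q) (Z.price q)

/-- The producer surplus of a market scheme. -/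
noncomputable def MarketScheme.PS {n : ℕ} {xstar : Fin n → ℝ} (v : Fin n → ℝ)
    (Z : MarketScheme xstar) : ℝ :=
  ∑ q, ps v (Z.seg q) (Z.price q)

/-- A market scheme is `F`-valid if every instructed price lies in `F` and is revenue-maximizing
in its segment. -/
def MarketScheme.IsValid {n : ℕ} {xstar : Fin n → ℝ} (v : Fin n → ℝ) (F : Finset (Fin n))
    (Z : MarketScheme xstar) : Prop :=
  ∀ q, Z.price q ∈ F ∧ IsOptPrice v (Z.seg q) (Z.price q)

/-- The price set `F` is `xstar`-feasible. -/
def IsFeasible {n : ℕ} (v xstar : Fin n → ℝ) (F : Finset (Fin n)) : Prop :=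
  ∃ Z : MarketScheme xstar, Z.IsValid v F

/-- The consumer surpluses of the `F`-valid market schemes for `xstar`. -/
def achievableCS {n : ℕ} (v xstar : Fin n → ℝ) (F : Finset (Fin n)) : Set ℝ :=
  {c | ∃ Z : MarketScheme xstar, Z.IsValid v F ∧ Z.CS v = c}

/-- The minimal consumer surplus over the `F`-valid market schemes for `xstar`. -/
noncomputable def minCS {n : ℕ} (v xstar : Fin n → ℝ) (F : Finset (Fin n)) : ℝ :=
  sInf (achievableCS v xstar F)

/-- A market scheme is `(F, i, η)`-valid, for `F = {v ℓ, ..., v r}`, if it is `F`-valid, uses only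
prices from `{v i, ..., v r}`, and the buyers of value `v i` that are in segments of price `v i`
have total mass at most `η`. -/
def MarketScheme.IsSubValid {n : ℕ} {xstar : Fin n → ℝ} (v : Fin n → ℝ) (ℓ r i : Fin n) (η : ℝ)
    (Z : MarketScheme xstar) : Prop :=
  Z.IsValid v (Finset.Icc ℓ r) ∧ (∀ q, Z.price q ∈ Finset.Icc i r) ∧
    ∑ q with Z.price q = i, Z.seg q i ≤ η

/-- `(F, i, η)` is `xstar`-sub-feasible, for `F = {v ℓ, ..., v r}`. -/
def IsSubFeasible {n : ℕ} (v xstar : Fin n → ℝ) (ℓ r i : Fin n) (η : ℝ) : Prop :=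
  ∃ Z : MarketScheme xstar, Z.IsSubValid v ℓ r i η

open Classical in
/-- The largest index `i₀` in `{ℓ, ..., r}` such that `{v i₀, ..., v r}` is `xstar`-feasible. -/
noncomputable def minimalIndex {n : ℕ} (v xstar : Fin n → ℝ) (ℓ r : Fin n) (hℓr : ℓ ≤ r)
    (hF : IsFeasible v xstar (Finset.Icc ℓ r)) : Fin n :=
  Finset.max' {i ∈ Finset.Icc ℓ r | IsFeasible v xstar (Finset.Icc i r)}
    ⟨ℓ, Finset.mem_filter.mpr ⟨Finset.left_mem_Icc.mpr hℓr, hF⟩⟩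

/-- The infimum of the `η ∈ [0, xstar i]` such that `(F, i, η)` is `xstar`-sub-feasible. -/
noncomputable def minimalMass {n : ℕ} (v xstar : Fin n → ℝ) (ℓ r i : Fin n) : ℝ :=
  sInf {η : ℝ | 0 ≤ η ∧ η ≤ xstar i ∧ IsSubFeasible v xstar ℓ r i η}

end PriceRegulation

namespace PriceRegulation

open Finset

/-! ### Linearity and monotonicity of demand, revenue and surplus; modifying one or two segments. -/

section Basics

variable {n : ℕ} {v : Fin n → ℝ}

/-! Welfare, `CS + PS`, depends only on who is served, and `PS` is at least the uniform revenue. So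
surplus is smallest when few buyers of low value are served and `PS` equals the uniform revenue.

Lower bound: merge the segments of a valid scheme by price and keep only the buyers served. Among
such families take one that minimizes `CS`, then `PS`, then maximizes price-weighted revenue, then
the correlation of prices and values. Let `a` be its lowest active price. Three perturbations
(`exists_raise`, `exists_swap`, `exists_remove`) show that everyone above `v a` is served and that
`PS` is the uniform revenue (`IsServed.exists_top`). Hence `CS = η * v a + ∑_{j > a} x j * v j -
uniformRevenue`, with `η = y a a`. Water-filling puts the unserved buyers back without disturbing
the prices (`IsServed.exists_family`), so `a` and `η` compete in the definitions of `minimalIndex`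
and `minimalMass`, and the claimed value is a lower bound.

Attainment: by compactness some family with prices in `Icc i₀ r` realizes the minimal mass. Its
welfare is at most the first two terms of the formula and its `PS` at least the uniform revenue;
against the lower bound, both inequalities are equalities. -/

lemma demand_eq (hv : StrictMono v) (x : Fin n → ℝ) (p : Fin n) :
    demand v x p = ∑ i ∈ Ici p, x i := by
  unfold demand
  congr 1
  ext i
  simp [hv.le_iff_le]

lemma cs_eq (hv : StrictMono v) (x : Fin n → ℝ) (p : Fin n) :
    cs v x p = ∑ i ∈ Ici p, (v i - v p) * x i := by
  unfold cs
  congr 1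
  ext i
  simp [hv.le_iff_le]

lemma ps_eq_revenue (x : Fin n → ℝ) (p : Fin n) : ps v x p = revenue v x p := by
  simp [ps, revenue, demand, mul_sum]

lemma cs_add_revenue (hv : StrictMono v) (x : Fin n → ℝ) (p : Fin n) :
    cs v x p + revenue v x p = ∑ i ∈ Ici p, v i * x i := by
  rw [cs_eq hv, revenue, demand_eq hv, mul_sum, ← sum_add_distrib]
  exact sum_congr rfl fun i _ => by ring

@[simp] lemma demand_zero (p : Fin n) : demand v 0 p = 0 := by simp [demand]

@[simp] lemma revenue_zero (p : Fin n) : revenue v 0 p = 0 := by simp [revenue]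

@[simp] lemma cs_zero (p : Fin n) : cs v 0 p = 0 := by simp [cs]

lemma demand_add (x y : Fin n → ℝ) (p : Fin n) :
    demand v (x + y) p = demand v x p + demand v y p := by
  simp [demand, sum_add_distrib]

lemma demand_smul (c : ℝ) (x : Fin n → ℝ) (p : Fin n) :
    demand v (c • x) p = c * demand v x p := by
  simp [demand, mul_sum]

lemma demand_sum {ι : Type*} (s : Finset ι) (y : ι → Fin n → ℝ) (p : Fin n) :
    demand v (∑ q ∈ s, y q) p = ∑ q ∈ s, demand v (y q) p := by
  simp only [demand, Finset.sum_apply]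
  exact sum_comm

lemma revenue_add (x y : Fin n → ℝ) (p : Fin n) :
    revenue v (x + y) p = revenue v x p + revenue v y p := by
  simp [revenue, demand_add, mul_add]

lemma revenue_smul (c : ℝ) (x : Fin n → ℝ) (p : Fin n) :
    revenue v (c • x) p = c * revenue v x p := by
  simp only [revenue, demand_smul]; ring

lemma revenue_sum {ι : Type*} (s : Finset ι) (y : ι → Fin n → ℝ) (p : Fin n) :
    revenue v (∑ q ∈ s, y q) p = ∑ q ∈ s, revenue v (y q) p := by
  simp only [revenue, demand_sum, mul_sum]

lemma cs_add (x y : Fin n → ℝ) (p : Fin n) : cs v (x + y) p = cs v x p + cs v y p := by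
  simp [cs, mul_add, sum_add_distrib]

lemma cs_smul (c : ℝ) (x : Fin n → ℝ) (p : Fin n) : cs v (c • x) p = c * cs v x p := by
  simp only [cs, mul_sum, Pi.smul_apply, smul_eq_mul]
  exact sum_congr rfl fun i _ => by ring

lemma cs_sum {ι : Type*} (s : Finset ι) (y : ι → Fin n → ℝ) (p : Fin n) :
    cs v (∑ q ∈ s, y q) p = ∑ q ∈ s, cs v (y q) p := by
  simp only [cs, Finset.sum_apply, mul_sum]
  exact sum_comm

lemma demand_single (hv : StrictMono v) (i : Fin n) (c : ℝ) (p : Fin n) :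
    demand v (Pi.single i c) p = if p ≤ i then c else 0 := by
  simp [demand_eq hv, Pi.single_apply]

lemma cs_single (hv : StrictMono v) (i : Fin n) (c : ℝ) (p : Fin n) :
    cs v (Pi.single i c) p = if p ≤ i then (v i - v p) * c else 0 := by
  simp [cs_eq hv, Pi.single_apply]

lemma demand_nonneg {x : Fin n → ℝ} (hx : ∀ i, 0 ≤ x i) (p : Fin n) : 0 ≤ demand v x p :=
  sum_nonneg fun i _ => hx i

lemma demand_mono {x y : Fin n → ℝ} (h : ∀ i, x i ≤ y i) (p : Fin n) :
    demand v x p ≤ demand v y p :=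
  sum_le_sum fun i _ => h i

lemma demand_antitone (hv : StrictMono v) {x : Fin n → ℝ} (hx : ∀ i, 0 ≤ x i) :
    Antitone (demand v x) := by
  intro p p' h
  rw [demand_eq hv, demand_eq hv]
  exact sum_le_sum_of_subset_of_nonneg (Ici_subset_Ici.mpr h) fun i _ _ => hx i

lemma revenue_nonneg (hv_pos : ∀ i, 0 < v i) {x : Fin n → ℝ} (hx : ∀ i, 0 ≤ x i) (p : Fin n) :
    0 ≤ revenue v x p :=
  mul_nonneg (hv_pos p).le (demand_nonneg hx p)

lemma revenue_le_uniformRevenue (x : Fin n → ℝ) (p : Fin n) :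
    revenue v x p ≤ uniformRevenue v x :=
  le_ciSup (f := fun p => revenue v x p) (Set.finite_range _).bddAbove p

lemma uniformRevenue_le [Nonempty (Fin n)] {x : Fin n → ℝ} {c : ℝ}
    (h : ∀ p, revenue v x p ≤ c) : uniformRevenue v x ≤ c :=
  ciSup_le h

lemma isOptPrice_zero (p : Fin n) : IsOptPrice v 0 p := fun p' => by simp

lemma IsOptPrice.add {x y : Fin n → ℝ} {p : Fin n} (hx : IsOptPrice v x p)
    (hy : IsOptPrice v y p) : IsOptPrice v (x + y) p := fun p' => by
  rw [revenue_add, revenue_add]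
  exact add_le_add (hx p') (hy p')

lemma IsOptPrice.smul {x : Fin n → ℝ} {p : Fin n} (hx : IsOptPrice v x p) {c : ℝ} (hc : 0 ≤ c) :
    IsOptPrice v (c • x) p := fun p' => by
  rw [revenue_smul, revenue_smul]
  exact mul_le_mul_of_nonneg_left (hx p') hc

lemma IsOptPrice.sum {ι : Type*} {s : Finset ι} {y : ι → Fin n → ℝ} {p : Fin n}
    (h : ∀ q ∈ s, IsOptPrice v (y q) p) : IsOptPrice v (∑ q ∈ s, y q) p := fun p' => by
  rw [revenue_sum, revenue_sum]
  exact sum_le_sum fun q hq => h q hq p'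

/-- An optimal price with positive revenue is the value of some buyers. -/
lemma IsOptPrice.mass_pos (hv : StrictMono v) (hv_pos : ∀ i, 0 < v i) {x : Fin n → ℝ}
    (hx : ∀ i, 0 ≤ x i) {p : Fin n} (hopt : IsOptPrice v x p) (hpos : 0 < revenue v x p) :
    0 < x p := by
  have hD : 0 < demand v x p := pos_of_mul_pos_right hpos (hv_pos p).le
  have hne : ({i ∈ Ici p | 0 < x i} : Finset (Fin n)).Nonempty := by
    by_contra hcon
    rw [not_nonempty_iff_eq_empty, filter_eq_empty_iff] at hcon
    rw [demand_eq hv, sum_eq_zero fun i hi => le_antisymm (not_lt.mp (hcon hi)) (hx i)] at hD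
    exact hD.false
  obtain ⟨m, hm, hmin⟩ := exists_min_image _ id hne
  rw [mem_filter, mem_Ici] at hm
  rcases hm.1.eq_or_lt with rfl | hlt
  · exact hm.2
  exfalso
  -- If the lowest value `v m` present at or above `v p` exceeded `v p`, charging `v m` would sell
  -- to the same buyers at a higher price.
  have hDeq : demand v x m = demand v x p := by
    rw [demand_eq hv, demand_eq hv]
    refine sum_subset (Ici_subset_Ici.mpr hm.1) fun i hi him => ?_
    by_contra hne0
    refine him (mem_Ici.mpr (hmin i (mem_filter.mpr ⟨hi, ?_⟩)))
    exact lt_of_le_of_ne (hx i) (Ne.symm hne0)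
  have := hopt m
  rw [revenue, revenue, hDeq] at this
  exact absurd (le_of_mul_le_mul_right this hD) (not_le.mpr (hv hlt))

lemma demand_eq_of_le (hv : StrictMono v) {x : Fin n → ℝ} {k t : Fin n}
    (hsupp : ∀ i, i < k → x i = 0) (ht : t ≤ k) : demand v x t = demand v x k := by
  rw [demand_eq hv, demand_eq hv]
  symm
  refine sum_subset (Ici_subset_Ici.mpr ht) fun i _ hi => hsupp i ?_
  simpa using hi

lemma sum_update {ι β : Type*} [Fintype ι] [DecidableEq ι] (g : ι → β → ℝ) (y : ι → β) (a : ι)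
    (u : β) :
    ∑ k, g k (Function.update y a u k) = ∑ k, g k (y k) - g a (y a) + g a u := by
  rw [← add_sum_erase _ _ (mem_univ a), ← add_sum_erase univ (fun k => g k (y k)) (mem_univ a)]
  rw [Function.update_self, sum_congr rfl fun k hk => by
    rw [Function.update_of_ne (ne_of_mem_erase hk)]]
  ring

lemma sum_update_update {ι β : Type*} [Fintype ι] [DecidableEq ι] (g : ι → β → ℝ) (y : ι → β)
    {a b : ι} (hab : a ≠ b) (u w : β) :
    ∑ k, g k (Function.update (Function.update y a u) b w k) =
      ∑ k, g k (y k) - g a (y a) - g b (y b) + g a u + g b w := by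
  rw [sum_update, sum_update, Function.update_of_ne hab.symm]
  ring

lemma forall_update_update {ι β : Type*} [DecidableEq ι] {P : ι → β → Prop} {y : ι → β} {a b : ι}
    {u w : β} (hy : ∀ k, P k (y k)) (hu : P a u) (hw : P b w) (k : ι) :
    P k (Function.update (Function.update y a u) b w k) := by
  by_cases hkb : k = b
  · subst hkb; rwa [Function.update_self]
  rw [Function.update_of_ne hkb]
  by_cases hka : k = a
  · subst hka; rwa [Function.update_self]
  rw [Function.update_of_ne hka]
  exact hy k

end Basics

/-! ### Truncating a market to the buyers who can afford a price. -/

section Above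

variable {n : ℕ} {v : Fin n → ℝ}

/-- The part of the market `x` consisting of the buyers of value at least `v j`. -/
def above (j : Fin n) (x : Fin n → ℝ) : Fin n → ℝ := fun i => if j ≤ i then x i else 0

lemma above_nonneg {x : Fin n → ℝ} (hx : ∀ i, 0 ≤ x i) (j i : Fin n) : 0 ≤ above j x i := by
  unfold above; split_ifs <;> simp [hx]

lemma demand_above (hv : StrictMono v) (x : Fin n → ℝ) (j p : Fin n) :
    demand v (above j x) p = demand v x (max p j) := by
  simp only [demand_eq hv, above, ← sum_filter]
  congr 1
  ext i
  simp

lemma revenue_above_self (hv : StrictMono v) (x : Fin n → ℝ) (j : Fin n) :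
    revenue v (above j x) j = revenue v x j := by
  simp [revenue, demand_above hv]

lemma cs_above_self (hv : StrictMono v) (x : Fin n → ℝ) (j : Fin n) :
    cs v (above j x) j = cs v x j := by
  rw [cs_eq hv, cs_eq hv]
  refine sum_congr rfl fun i hi => ?_
  simp [above, mem_Ici.mp hi]

lemma cs_antitone (hv : StrictMono v) {x : Fin n → ℝ} (hx : ∀ i, 0 ≤ x i) {a j : Fin n}
    (h : a ≤ j) : cs v x j ≤ cs v x a := by
  rw [cs_eq hv, cs_eq hv]
  calc ∑ i ∈ Ici j, (v i - v j) * x i ≤ ∑ i ∈ Ici j, (v i - v a) * x i :=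
        sum_le_sum fun i _ =>
          mul_le_mul_of_nonneg_right (by linarith [hv.monotone h]) (hx i)
    _ ≤ _ := sum_le_sum_of_subset_of_nonneg (Ici_subset_Ici.mpr h) fun i hi _ =>
          mul_nonneg (by linarith [hv.monotone (mem_Ici.mp hi)]) (hx i)

end Above

/-! ### Families of served buyers, and raising the lowest price. -/

section Served

variable {n : ℕ}

/-- The buyers served by an `{v ℓ, ..., v r}`-valid market scheme, grouped by price: `y k i` is the
mass of the buyers of value `v i` that buy at price `v k`. -/
structure IsServed (v x : Fin n → ℝ) (ℓ r : Fin n) (y : Fin n → Fin n → ℝ) : Prop where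
  nonneg : ∀ k i, 0 ≤ y k i
  price_mem : ∀ k, k ∉ Icc ℓ r → y k = 0
  supp : ∀ k i, i < k → y k i = 0
  opt : ∀ k, IsOptPrice v (y k) k
  sum_le : ∀ i, ∑ k, y k i ≤ x i
  sum_eq : ∀ i, r < i → ∑ k, y k i = x i
  rev_le : uniformRevenue v x ≤ ∑ k, revenue v (y k) k

/-- The consumer surplus of a family of segments indexed by their prices. -/
noncomputable def famCS (v : Fin n → ℝ) (y : Fin n → Fin n → ℝ) : ℝ := ∑ k, cs v (y k) k

/-- The producer surplus of a family of segments indexed by their prices. -/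
noncomputable def famPS (v : Fin n → ℝ) (y : Fin n → Fin n → ℝ) : ℝ := ∑ k, revenue v (y k) k

/-- The revenue of a family of segments, weighted by the prices. -/
noncomputable def weightedPS (v : Fin n → ℝ) (y : Fin n → Fin n → ℝ) : ℝ :=
  ∑ k, v k * revenue v (y k) k

/-- The correlation of prices and values in a family of segments. -/
noncomputable def correlation (v : Fin n → ℝ) (y : Fin n → Fin n → ℝ) : ℝ :=
  ∑ k, v k * ∑ i, v i * y k i

variable {v x : Fin n → ℝ} {ℓ r : Fin n} {y : Fin n → Fin n → ℝ}

lemma IsServed.mem_of_revenue_pos (h : IsServed v x ℓ r y) {k : Fin n}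
    (hk : 0 < revenue v (y k) k) : ℓ ≤ k ∧ k ≤ r := by
  by_contra hcon
  rw [h.price_mem k (by simpa using hcon), revenue_zero] at hk
  exact hk.false

lemma IsServed.eq_zero_of_revenue (hv : StrictMono v) (hv_pos : ∀ i, 0 < v i)
    (h : IsServed v x ℓ r y) {k : Fin n} (hk : ¬ 0 < revenue v (y k) k) : y k = 0 := by
  have hR : revenue v (y k) k = 0 :=
    le_antisymm (not_lt.mp hk) (revenue_nonneg hv_pos (h.nonneg k) k)
  have hD : demand v (y k) k = 0 := (mul_eq_zero.mp hR).resolve_left (hv_pos k).ne'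
  rw [demand_eq hv, sum_eq_zero_iff_of_nonneg fun i _ => h.nonneg k i] at hD
  funext i
  rcases lt_or_ge i k with hik | hik
  · exact h.supp k i hik
  · exact hD i (mem_Ici.mpr hik)

/-- Part of the segment of price `v a` can be moved to the price `v j`, after enough buyers of
value `v j` have been added to make that price optimal. -/
lemma IsServed.exists_raise (hv : StrictMono v) (hv_pos : ∀ i, 0 < v i)
    (h : IsServed v x ℓ r y) {a j : Fin n} (haj : a < j) (hjr : j ≤ r)
    (hpos : 0 < revenue v (y a) a) {θ : ℝ} (hθ : 0 < θ) (hθ1 : θ ≤ 1)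
    (hroom : θ * (revenue v (y a) a / v j - demand v (y a) j) ≤ x j - ∑ k, y k j) :
    ∃ y', IsServed v x ℓ r y' ∧ famCS v y' ≤ famCS v y ∧ famPS v y' = famPS v y ∧
      weightedPS v y < weightedPS v y' := by
  obtain ⟨hℓa, -⟩ := h.mem_of_revenue_pos hpos
  set R := revenue v (y a) a with hR
  set δ := R / v j - demand v (y a) j with hδ
  have hδ0 : 0 ≤ δ := by
    have := h.opt a j
    rw [revenue] at this
    rw [hδ, sub_nonneg, le_div_iff₀ (hv_pos j)]
    linarith
  set w : Fin n → ℝ := above j (y a) + Pi.single j δ with hw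
  have hw_dem : ∀ t, demand v w t = if t ≤ j then R / v j else demand v (y a) t := by
    intro t
    rw [hw, demand_add, demand_above hv, demand_single hv]
    split_ifs with ht
    · rw [max_eq_right ht, hδ]; ring
    · rw [max_eq_left (not_le.mp ht).le]; ring
  have hw_rev : revenue v w j = R := by
    rw [revenue, hw_dem, if_pos le_rfl, mul_div_cancel₀ _ (hv_pos j).ne']
  have hw_opt : IsOptPrice v w j := by
    intro t
    rw [hw_rev, revenue, hw_dem]
    split_ifs with ht
    · rw [mul_div_assoc', div_le_iff₀ (hv_pos j), mul_comm]
      exact mul_le_mul_of_nonneg_left (hv.monotone ht) hpos.le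
    · exact h.opt a t
  have hw_cs : cs v w j ≤ cs v (y a) a := by
    rw [hw, cs_add, cs_above_self hv, cs_single hv, if_pos le_rfl, sub_self, zero_mul, add_zero]
    exact cs_antitone hv (h.nonneg a) haj.le
  have hw_nonneg : ∀ i, 0 ≤ w i := by
    intro i
    refine add_nonneg (above_nonneg (h.nonneg a) j i) ?_
    rw [Pi.single_apply]; split_ifs <;> simp [hδ0]
  have hne : a ≠ j := haj.ne
  -- Only a fraction `θ` of the segment is moved, so `hroom` asks for just `θ * δ` unserved buyers
  -- of value `v j`.
  refine ⟨Function.update (Function.update y a ((1 - θ) • y a)) j (y j + θ • w), ?_, ?_, ?_, ?_⟩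
  · have hsum : ∀ i, ∑ k, Function.update (Function.update y a ((1 - θ) • y a)) j
        (y j + θ • w) k i = ∑ k, y k i + θ * (w i - y a i) := by
      intro i
      rw [sum_update_update (fun _ z => z i) y hne]
      simp only [Pi.add_apply, Pi.smul_apply, smul_eq_mul]
      ring
    refine ⟨?_, ?_, ?_, ?_, ?_, ?_, ?_⟩
    · refine forall_update_update (P := fun (_ : Fin n) (z : Fin n → ℝ) => ∀ i, 0 ≤ z i) h.nonneg
        (fun i => ?_) (fun i => ?_)
      · exact mul_nonneg (by linarith) (h.nonneg a i)
      · exact add_nonneg (h.nonneg j i) (mul_nonneg hθ.le (hw_nonneg i))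
    · refine forall_update_update (P := fun k (z : Fin n → ℝ) => k ∉ Icc ℓ r → z = 0) h.price_mem
        (fun ha => ?_) (fun hj => ?_)
      · rw [h.price_mem a ha, smul_zero]
      · exact absurd (mem_Icc.mpr ⟨hℓa.trans haj.le, hjr⟩) hj
    · refine forall_update_update (P := fun k (z : Fin n → ℝ) => ∀ i, i < k → z i = 0) h.supp
        (fun i hi => ?_) (fun i hi => ?_)
      · simp [h.supp a i hi]
      · simp [h.supp j i hi, hw, above, not_le.mpr hi, hi.ne]
    · exact forall_update_update (P := fun k z => IsOptPrice v z k) h.opt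
        ((h.opt a).smul (by linarith))
        ((h.opt j).add (hw_opt.smul hθ.le))
    · intro i
      rw [hsum]
      have h1 := h.sum_le i
      have h2 := h.nonneg a i
      by_cases hij : i = j
      · subst hij
        simp only [hw, Pi.add_apply, above, le_refl, if_true, Pi.single_eq_same]
        linarith
      · have : w i ≤ y a i := by
          simp only [hw, Pi.add_apply, above, Pi.single_eq_of_ne hij, add_zero]
          split_ifs <;> simp [h2]
        nlinarith
    · intro i hi
      have hji : j < i := hjr.trans_lt hi
      rw [hsum, h.sum_eq i hi]
      simp [hw, above, hji.le, Pi.single_eq_of_ne hji.ne']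
    · rw [sum_update_update (fun k z => revenue v z k) y hne, revenue_smul, revenue_add,
        revenue_smul, hw_rev]
      have := h.rev_le
      linarith
  · rw [famCS, sum_update_update (fun k z => cs v z k) y hne, cs_smul, cs_add, cs_smul, famCS]
    nlinarith
  · rw [famPS, sum_update_update (fun k z => revenue v z k) y hne, revenue_smul, revenue_add,
      revenue_smul, hw_rev, famPS]
    linarith
  · rw [weightedPS, weightedPS, sum_update_update (fun k z => v k * revenue v z k) y hne,
      revenue_smul, revenue_add, revenue_smul, hw_rev, ← hR]
    have : 0 < θ * R * (v j - v a) := mul_pos (mul_pos hθ hpos) (sub_pos.mpr (hv haj))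
    nlinarith

end Served

/-! ### Exchanging buyers between two segments, and removing buyers without surplus. -/

section Perturbation

variable {n : ℕ} {v x : Fin n → ℝ} {ℓ r : Fin n} {y : Fin n → Fin n → ℝ}

lemma eventually_add_mul_le {A B C : ℝ} (h : A < C) :
    ∀ᶠ ε in nhdsWithin (0 : ℝ) (Set.Ioi 0), A + B * ε ≤ C := by
  have hc : Filter.Tendsto (fun ε : ℝ => A + B * ε) (nhds 0) (nhds (A + B * 0)) :=
    (by fun_prop : Continuous fun ε : ℝ => A + B * ε).tendsto 0
  rw [mul_zero, add_zero] at hc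
  exact ((hc.eventually (gt_mem_nhds h)).filter_mono nhdsWithin_le_nhds).mono fun _ => le_of_lt

/-- If the price `v T` is optimal in the segment of price `v a` but not in that of a higher price
`v k`, then some buyers of value `v T` can be exchanged for buyers of lower value. -/
lemma IsServed.exists_swap (hv : StrictMono v) (hv_pos : ∀ i, 0 < v i)
    (h : IsServed v x ℓ r y) {a k T : Fin n} (hak : a < k) (hrT : r < T)
    (hpos : 0 < revenue v (y a) a) (htight : revenue v (y a) T = revenue v (y a) a)
    (hslack : revenue v (y k) T < revenue v (y k) k) :
    ∃ y', IsServed v x ℓ r y' ∧ famCS v y' = famCS v y ∧ famPS v y' = famPS v y ∧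
      weightedPS v y' = weightedPS v y ∧ correlation v y < correlation v y' := by
  have hkpos : 0 < revenue v (y k) k := (revenue_nonneg hv_pos (h.nonneg k) T).trans_lt hslack
  have hkr := (h.mem_of_revenue_pos hkpos).2
  have haℓ := h.mem_of_revenue_pos hpos
  have haT : 0 < y a T := IsOptPrice.mass_pos hv hv_pos (h.nonneg a)
    (fun p => (h.opt a p).trans htight.ge) (htight ▸ hpos)
  -- `S` is the last tight price of segment `k` before `T`; the set contains `k` because `k ≤ r <
  -- T`. All constraints of segment `k` on `(S, T]` are then slack.
  obtain ⟨S, hS, hmax⟩ := exists_max_image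
    ({t | t < T ∧ revenue v (y k) t = revenue v (y k) k} : Finset (Fin n)) id
    ⟨k, by simp [hkr.trans_lt hrT]⟩
  simp only [mem_filter, mem_univ, true_and, id] at hS hmax
  obtain ⟨hST, hSt⟩ := hS
  have hkS : k ≤ S := hmax k ⟨hkr.trans_lt hrT, rfl⟩
  have hSk : 0 < y k S := IsOptPrice.mass_pos hv hv_pos (h.nonneg k)
    (fun p => (h.opt k p).trans hSt.ge) (hSt ▸ hkpos)
  have hstrict : ∀ t, S < t → t ≤ T → revenue v (y k) t < revenue v (y k) k := by
    intro t hSlt htT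
    rcases htT.eq_or_lt with rfl | htT
    · exact hslack
    · exact lt_of_le_of_ne (h.opt k t) fun heq => not_lt.mpr (hmax t ⟨htT, heq⟩) hSlt
  have hev : ∀ᶠ ε in nhdsWithin (0 : ℝ) (Set.Ioi 0), ∀ t, S < t → t ≤ T →
      revenue v (y k) t + v t * ε ≤ revenue v (y k) k := by
    rw [Filter.eventually_all]
    intro t
    by_cases ht : S < t ∧ t ≤ T
    · exact (eventually_add_mul_le (hstrict t ht.1 ht.2)).mono fun ε hε _ _ => hε
    · exact Filter.Eventually.of_forall fun ε h1 h2 => absurd ⟨h1, h2⟩ ht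
  obtain ⟨ε, hε1, hεa, hεk, hε⟩ := (hev.and ((eventually_add_mul_le (B := 1) haT).and
    ((eventually_add_mul_le (B := 1) hSk).and self_mem_nhdsWithin))).exists
  rw [zero_add, one_mul] at hεa hεk
  -- Segment `a` trades `ε` buyers of value `v T` for as many of value `v S`. Demand changes only on
  -- `(S, T]`: it falls in segment `a` and rises in segment `k`, where there is slack.
  set u : Fin n → ℝ := y a + (Pi.single S ε + Pi.single T (-ε)) with hu
  set w : Fin n → ℝ := y k + (Pi.single S (-ε) + Pi.single T ε) with hw
  have haS : a < S := hak.trans_le hkS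
  have hudem : ∀ t, demand v u t =
      demand v (y a) t + ((if t ≤ S then ε else 0) + if t ≤ T then -ε else 0) := fun t => by
    rw [hu, demand_add, demand_add, demand_single hv, demand_single hv]
  have hwdem : ∀ t, demand v w t =
      demand v (y k) t + ((if t ≤ S then -ε else 0) + if t ≤ T then ε else 0) := fun t => by
    rw [hw, demand_add, demand_add, demand_single hv, demand_single hv]
  have hurev : revenue v u a = revenue v (y a) a := by
    rw [revenue, revenue, hudem, if_pos haS.le, if_pos (haS.trans hST).le]; ring
  have hwrev : revenue v w k = revenue v (y k) k := by
    rw [revenue, revenue, hwdem, if_pos hkS, if_pos (hkS.trans hST.le)]; ring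
  have hune : ∀ i, i ≠ S → i ≠ T → u i = y a i := fun i h1 h2 => by
    simp [hu, Pi.single_eq_of_ne h1, Pi.single_eq_of_ne h2]
  have hwne : ∀ i, i ≠ S → i ≠ T → w i = y k i := fun i h1 h2 => by
    simp [hw, Pi.single_eq_of_ne h1, Pi.single_eq_of_ne h2]
  have huS : u S = y a S + ε := by simp [hu, Pi.single_eq_of_ne hST.ne]
  have huT : u T = y a T - ε := by simp [hu, Pi.single_eq_of_ne hST.ne', sub_eq_add_neg]
  have hwS : w S = y k S - ε := by simp [hw, Pi.single_eq_of_ne hST.ne, sub_eq_add_neg]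
  have hwT : w T = y k T + ε := by simp [hw, Pi.single_eq_of_ne hST.ne']
  have hsum : ∀ i, ∑ l, Function.update (Function.update y a u) k w l i = ∑ l, y l i := by
    intro i
    rw [sum_update_update (fun _ z => z i) y hak.ne]
    simp only [hu, hw, Pi.add_apply, Pi.single_apply]
    split_ifs <;> ring
  refine ⟨Function.update (Function.update y a u) k w, ⟨?_, ?_, ?_, ?_, ?_, ?_, ?_⟩,
    ?_, ?_, ?_, ?_⟩
  · refine forall_update_update (P := fun (_ : Fin n) (z : Fin n → ℝ) => ∀ i, 0 ≤ z i) h.nonneg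
      (fun i => ?_) (fun i => ?_)
    · by_cases h1 : i = S
      · rw [h1, huS]; linarith [h.nonneg a S]
      by_cases h2 : i = T
      · rw [h2, huT]; linarith
      rw [hune i h1 h2]; exact h.nonneg a i
    · by_cases h1 : i = S
      · rw [h1, hwS]; linarith
      by_cases h2 : i = T
      · rw [h2, hwT]; linarith [h.nonneg k T]
      rw [hwne i h1 h2]; exact h.nonneg k i
  · exact forall_update_update (P := fun k (z : Fin n → ℝ) => k ∉ Icc ℓ r → z = 0) h.price_mem
      (fun ha => absurd (mem_Icc.mpr haℓ) ha)
      (fun hk => absurd (mem_Icc.mpr (h.mem_of_revenue_pos hkpos)) hk)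
  · refine forall_update_update (P := fun k (z : Fin n → ℝ) => ∀ i, i < k → z i = 0) h.supp
      (fun i hi => ?_) (fun i hi => ?_)
    · have := hi.trans haS
      rw [hune i this.ne (this.trans hST).ne, h.supp a i hi]
    · have := hi.trans_le hkS
      rw [hwne i this.ne (this.trans hST).ne, h.supp k i hi]
  · refine forall_update_update (P := fun k z => IsOptPrice v z k) h.opt (fun t => ?_)
      (fun t => ?_)
    · rw [hurev]
      refine le_trans ?_ (h.opt a t)
      refine mul_le_mul_of_nonneg_left ?_ (hv_pos t).le
      rw [hudem]
      split_ifs with h1 h2 h2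
      · linarith
      · exact absurd (h1.trans hST.le) h2
      · linarith
      · linarith
    · rw [hwrev, revenue, hwdem]
      split_ifs with h1 h2 h2
      · simpa [revenue] using h.opt k t
      · exact absurd (h1.trans hST.le) h2
      · have := hε1 t (not_le.mp h1) h2
        rw [revenue] at this
        linarith
      · simpa [revenue] using h.opt k t
  · exact fun i => (hsum i).trans_le (h.sum_le i)
  · exact fun i hi => (hsum i).trans (h.sum_eq i hi)
  · rw [sum_update_update (fun k z => revenue v z k) y hak.ne, hurev, hwrev]
    linarith [h.rev_le]
  · rw [famCS, sum_update_update (fun k z => cs v z k) y hak.ne, famCS, hu, hw, cs_add, cs_add,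
      cs_add, cs_add, cs_single hv, cs_single hv, cs_single hv, cs_single hv, if_pos haS.le,
      if_pos (haS.trans hST).le, if_pos hkS, if_pos (hkS.trans hST.le)]
    ring
  · rw [famPS, sum_update_update (fun k z => revenue v z k) y hak.ne, famPS, hurev, hwrev]
    ring
  · rw [weightedPS, sum_update_update (fun k z => v k * revenue v z k) y hak.ne, weightedPS,
      hurev, hwrev]
    ring
  · have hlin : ∀ (z : Fin n → ℝ) (b c : ℝ),
        ∑ i, v i * (z + (Pi.single S b + Pi.single T c) : Fin n → ℝ) i =
        ∑ i, v i * z i + (v S * b + v T * c) := by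
      intro z b c
      simp [mul_add, sum_add_distrib, Pi.single_apply]
    rw [correlation, correlation, sum_update_update (fun k z => v k * ∑ i, v i * z i) y hak.ne,
      hu, hw, hlin, hlin]
    have : 0 < ε * ((v k - v a) * (v T - v S)) :=
      mul_pos hε (mul_pos (sub_pos.mpr (hv hak)) (sub_pos.mpr (hv hST)))
    nlinarith

/-- If the price `v a` is the unique optimal one in its segment, then the producer surplus can be
lowered without changing the consumer surplus. -/
lemma IsServed.exists_remove (hv : StrictMono v) (hv_pos : ∀ i, 0 < v i)
    (h : IsServed v x ℓ r y) {a : Fin n} (hpos : 0 < revenue v (y a) a)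
    (hstrict : ∀ t, a < t → revenue v (y a) t < revenue v (y a) a)
    (hlt : uniformRevenue v x < famPS v y) :
    ∃ y', IsServed v x ℓ r y' ∧ famCS v y' = famCS v y ∧ famPS v y' < famPS v y := by
  have haℓ := h.mem_of_revenue_pos hpos
  have haa : 0 < y a a := IsOptPrice.mass_pos hv hv_pos (h.nonneg a) (h.opt a) hpos
  -- Removing `ε` buyers of value `v a` costs revenue `v a * ε` at price `v a` and none at higher
  -- prices, so strict optimality survives for small `ε`.
  have hev : ∀ᶠ ε in nhdsWithin (0 : ℝ) (Set.Ioi 0), ∀ t, a < t →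
      revenue v (y a) t + v a * ε ≤ revenue v (y a) a := by
    rw [Filter.eventually_all]
    intro t
    by_cases ht : a < t
    · exact (eventually_add_mul_le (hstrict t ht)).mono fun ε hε _ => hε
    · exact Filter.Eventually.of_forall fun ε h1 => absurd h1 ht
  obtain ⟨ε, hε1, hεa, hεR, hε⟩ := (hev.and ((eventually_add_mul_le (B := 1) haa).and
    ((eventually_add_mul_le (B := v a) hlt).and self_mem_nhdsWithin))).exists
  rw [zero_add, one_mul] at hεa
  set u : Fin n → ℝ := y a + Pi.single a (-ε) with hu
  have hune : ∀ i, i ≠ a → u i = y a i := fun i h1 => by simp [hu, Pi.single_eq_of_ne h1]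
  have hua : u a = y a a - ε := by simp [hu, sub_eq_add_neg]
  have hudem : ∀ t, demand v u t = demand v (y a) t + if t ≤ a then -ε else 0 := fun t => by
    rw [hu, demand_add, demand_single hv]
  have hurev : revenue v u a = revenue v (y a) a - v a * ε := by
    rw [revenue, revenue, hudem, if_pos le_rfl]; ring
  have hunn : ∀ i, 0 ≤ u i := fun i => by
    by_cases h1 : i = a
    · rw [h1, hua]; linarith
    · rw [hune i h1]; exact h.nonneg a i
  have husupp : ∀ i, i < a → u i = 0 := fun i hi => (hune i hi.ne).trans (h.supp a i hi)
  have hcases : ∀ {P : Fin n → (Fin n → ℝ) → Prop}, (∀ k, P k (y k)) → P a u →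
      ∀ k, P k (Function.update y a u k) := by
    intro P h1 h2 k
    by_cases hka : k = a
    · subst hka; rwa [Function.update_self]
    · rw [Function.update_of_ne hka]; exact h1 k
  have hsum : ∀ i, ∑ k, Function.update y a u k i =
        ∑ k, y k i + (Pi.single a (-ε) : Fin n → ℝ) i := by
    intro i
    rw [sum_update (fun _ z => z i) y]
    simp only [hu, Pi.add_apply]
    ring
  refine ⟨Function.update y a u, ⟨?_, ?_, ?_, ?_, ?_, ?_, ?_⟩, ?_, ?_⟩
  · exact hcases (P := fun (_ : Fin n) (z : Fin n → ℝ) => ∀ i, 0 ≤ z i) h.nonneg hunn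
  · exact hcases (P := fun k (z : Fin n → ℝ) => k ∉ Icc ℓ r → z = 0) h.price_mem
      fun ha => absurd (mem_Icc.mpr haℓ) ha
  · exact hcases (P := fun k (z : Fin n → ℝ) => ∀ i, i < k → z i = 0) h.supp husupp
  · refine hcases (P := fun k z => IsOptPrice v z k) h.opt fun t => ?_
    rcases le_or_gt t a with ht | ht
    · rw [revenue, revenue, demand_eq_of_le hv husupp ht]
      exact mul_le_mul_of_nonneg_right (hv.monotone ht) (demand_nonneg hunn a)
    · rw [hurev, revenue, hudem, if_neg (not_le.mpr ht), add_zero]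
      have := hε1 t ht
      rw [revenue] at this
      linarith
  · intro i
    rw [hsum]
    refine le_trans ?_ (h.sum_le i)
    rw [Pi.single_apply]
    split_ifs <;> linarith
  · intro i hi
    rw [hsum, h.sum_eq i hi, Pi.single_eq_of_ne (haℓ.2.trans_lt hi).ne', add_zero]
  · rw [sum_update (fun k z => revenue v z k) y, hurev]
    rw [famPS] at hεR
    linarith
  · rw [famCS, sum_update (fun k z => cs v z k) y, famCS, hu, cs_add, cs_single hv]
    simp
  · rw [famPS, sum_update (fun k z => revenue v z k) y, hurev, famPS]
    nlinarith [mul_pos (hv_pos a) hε]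

end Perturbation

/-! ### Compactness and the lexicographically extremal family. -/

section Extremal

variable {n : ℕ} {v x : Fin n → ℝ} {ℓ r : Fin n}

@[fun_prop]
lemma continuous_revenue (p : Fin n) : Continuous fun z : Fin n → ℝ => revenue v z p := by
  unfold revenue demand
  fun_prop

@[fun_prop]
lemma continuous_cs (p : Fin n) : Continuous fun z : Fin n → ℝ => cs v z p := by
  unfold cs
  fun_prop

lemma isClosed_isOptPrice (k : Fin n) :
    IsClosed {y : Fin n → Fin n → ℝ | IsOptPrice v (y k) k} := by
  simp only [IsOptPrice, Set.ofPred_forall]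
  refine isClosed_iInter fun p => isClosed_le ?_ ?_
  · exact (continuous_revenue p).comp (continuous_apply k)
  · exact (continuous_revenue k).comp (continuous_apply k)

lemma isCompact_isServed : IsCompact {y | IsServed v x ℓ r y} := by
  refine (isCompact_Icc (a := (0 : Fin n → Fin n → ℝ)) (b := fun _ => x)).of_isClosed_subset
    ?_ ?_
  · have : {y | IsServed v x ℓ r y} =
        {y | ∀ k i, 0 ≤ y k i} ∩ {y | ∀ k, k ∉ Icc ℓ r → y k = 0} ∩
        {y | ∀ k i, i < k → y k i = 0} ∩ {y | ∀ k, IsOptPrice v (y k) k} ∩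
        {y | ∀ i, ∑ k, y k i ≤ x i} ∩ {y | ∀ i, r < i → ∑ k, y k i = x i} ∩
        {y | uniformRevenue v x ≤ ∑ k, revenue v (y k) k} := by
      ext y
      exact ⟨fun h => ⟨⟨⟨⟨⟨⟨h.1, h.2⟩, h.3⟩, h.4⟩, h.5⟩, h.6⟩, h.7⟩,
        fun ⟨⟨⟨⟨⟨⟨h1, h2⟩, h3⟩, h4⟩, h5⟩, h6⟩, h7⟩ => ⟨h1, h2, h3, h4, h5, h6, h7⟩⟩
    rw [this]
    simp only [Set.ofPred_forall]
    refine ((((((?_ : IsClosed _).inter ?_).inter ?_).inter ?_).inter ?_).inter ?_).inter ?_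
    · exact isClosed_iInter fun k => isClosed_iInter fun i => isClosed_le (by fun_prop) (by fun_prop)
    · exact isClosed_iInter fun k => isClosed_iInter fun _ => isClosed_eq (by fun_prop) (by fun_prop)
    · exact isClosed_iInter fun k => isClosed_iInter fun i => isClosed_iInter fun _ =>
        isClosed_eq (by fun_prop) (by fun_prop)
    · exact isClosed_iInter isClosed_isOptPrice
    · exact isClosed_iInter fun i => isClosed_le (by fun_prop) (by fun_prop)
    · exact isClosed_iInter fun i => isClosed_iInter fun _ => isClosed_eq (by fun_prop) (by fun_prop)
    · exact isClosed_le (by fun_prop) (by fun_prop)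
  · intro y hy
    refine ⟨fun k i => hy.nonneg k i, fun k i => ?_⟩
    exact (single_le_sum (f := fun k => y k i) (fun k _ => hy.nonneg k i) (mem_univ k)).trans
      (hy.sum_le i)

lemma isCompact_nonempty_argmin {E : Type*} [TopologicalSpace E] {K : Set E} (hK : IsCompact K)
    (hne : K.Nonempty) {f : E → ℝ} (hf : Continuous f) :
    IsCompact {y ∈ K | ∀ z ∈ K, f y ≤ f z} ∧ {y ∈ K | ∀ z ∈ K, f y ≤ f z}.Nonempty := by
  obtain ⟨y, hy, hmin⟩ := hK.exists_isMinOn hne hf.continuousOn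
  refine ⟨?_, y, hy, fun z hz => hmin hz⟩
  have : {y ∈ K | ∀ z ∈ K, f y ≤ f z} = K ∩ {w | f w ≤ f y} := by
    ext w
    exact ⟨fun hw => ⟨hw.1, hw.2 y hy⟩, fun hw => ⟨hw.1, fun z hz => hw.2.trans (hmin hz)⟩⟩
  rw [this]
  exact hK.inter_right (isClosed_le hf continuous_const)

/-- The set of minimizers of a continuous function on a compact set is again compact and nonempty,
so minimization can be iterated. -/
lemma exists_lexMin {E : Type*} [TopologicalSpace E] {K : Set E} (hK : IsCompact K)
    (hne : K.Nonempty) {f g h e : E → ℝ} (hf : Continuous f) (hg : Continuous g)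
    (hh : Continuous h) (he : Continuous e) :
    ∃ y ∈ K, (∀ z ∈ K, f y ≤ f z) ∧ (∀ z ∈ K, f z ≤ f y → g y ≤ g z) ∧
      (∀ z ∈ K, f z ≤ f y → g z ≤ g y → h y ≤ h z) ∧
      ∀ z ∈ K, f z ≤ f y → g z ≤ g y → h z ≤ h y → e y ≤ e z := by
  obtain ⟨c1, n1⟩ := isCompact_nonempty_argmin hK hne hf
  obtain ⟨c2, n2⟩ := isCompact_nonempty_argmin c1 n1 hg
  obtain ⟨c3, n3⟩ := isCompact_nonempty_argmin c2 n2 hh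
  obtain ⟨-, y, h3, h4⟩ := isCompact_nonempty_argmin c3 n3 he
  have m1 : ∀ z ∈ K, f z ≤ f y → z ∈ {y ∈ K | ∀ z ∈ K, f y ≤ f z} :=
    fun z hz hzy => ⟨hz, fun w hw => hzy.trans (h3.1.1.2 w hw)⟩
  have m2 := fun z hz hzy (hg : g z ≤ g y) =>
    (⟨m1 z hz hzy, fun w hw => hg.trans (h3.1.2 w hw)⟩ :
      z ∈ {y ∈ {y ∈ K | ∀ z ∈ K, f y ≤ f z} | ∀ z ∈ {y ∈ K | ∀ z ∈ K, f y ≤ f z}, g y ≤ g z})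
  exact ⟨y, h3.1.1.1, h3.1.1.2, fun z hz h1 => h3.1.2 z (m1 z hz h1),
    fun z hz h1 h2 => h3.2 z (m2 z hz h1 h2),
    fun z hz h1 h2 h3' => h4 z ⟨m2 z hz h1 h2, fun w hw => h3'.trans (h3.2 w hw)⟩⟩

/-- Any served family can be improved to one that serves exactly the buyers of the highest values
and whose producer surplus is the uniform revenue. -/
lemma IsServed.exists_top (hv : StrictMono v) (hv_pos : ∀ i, 0 < v i) (hx : ∀ i, 0 ≤ x i)
    (hℓr : ℓ ≤ r) {y₀ : Fin n → Fin n → ℝ} (h₀ : IsServed v x ℓ r y₀) :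
    ∃ y a, IsServed v x ℓ r y ∧ famCS v y ≤ famCS v y₀ ∧ famPS v y = uniformRevenue v x ∧
      a ∈ Icc ℓ r ∧ (∀ k, k < a → y k = 0) ∧ ∀ i, a < i → ∑ k, y k i = x i := by
  obtain ⟨y, h, m1, m2, m3, m4⟩ := exists_lexMin (isCompact_isServed (v := v) (x := x) (ℓ := ℓ)
    (r := r)) ⟨y₀, h₀⟩ (f := famCS v) (g := famPS v) (h := fun y => -weightedPS v y)
    (e := fun y => -correlation v y) (by unfold famCS; fun_prop) (by unfold famPS; fun_prop)
    (by unfold weightedPS; fun_prop) (by unfold correlation; fun_prop)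
  rw [Set.mem_ofPred_eq] at h
  by_cases hne : ({k | 0 < revenue v (y k) k} : Finset (Fin n)).Nonempty
  swap
  · have hy : ∀ k, y k = 0 := fun k => h.eq_zero_of_revenue hv hv_pos fun hk =>
      hne ⟨k, by simpa using hk⟩
    have hps : famPS v y = 0 := by simp [famPS, hy]
    -- Nobody is served, so any index works for which all higher values are served; `r` does by
    -- `sum_eq`.
    refine ⟨y, r, h, m1 y₀ h₀, le_antisymm ?_ h.rev_le, right_mem_Icc.mpr hℓr, fun k _ => hy k,
      h.sum_eq⟩
    rw [hps]
    exact (revenue_nonneg hv_pos hx r).trans (revenue_le_uniformRevenue x r)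
  obtain ⟨a, ha, hmin⟩ := exists_min_image _ id hne
  simp only [mem_filter, mem_univ, true_and, id] at ha hmin
  have haℓ := h.mem_of_revenue_pos ha
  have hraise : ∀ j, a < j → j ≤ r → ∀ θ : ℝ, 0 < θ → θ ≤ 1 →
      ¬ θ * (revenue v (y a) a / v j - demand v (y a) j) ≤ x j - ∑ k, y k j := by
    intro j haj hjr θ hθ hθ1 hroom
    obtain ⟨y', h', h1, h2, h3⟩ := h.exists_raise hv hv_pos haj hjr ha hθ hθ1 hroom
    have := m3 y' h' h1 h2.le
    linarith
  -- Unserved buyers of value `v j` would leave room to raise a small fraction of segment `a` to `v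
  -- j`.
  have hserved : ∀ j, a < j → j ≤ r → ∑ k, y k j = x j := by
    intro j haj hjr
    by_contra hcon
    have hlt : 0 < x j - ∑ k, y k j := sub_pos.mpr (lt_of_le_of_ne (h.sum_le j) hcon)
    obtain ⟨θ, h1, h2, h3⟩ := ((eventually_add_mul_le (A := 0)
      (B := revenue v (y a) a / v j - demand v (y a) j) hlt).and
      ((eventually_add_mul_le (B := 1) zero_lt_one).and self_mem_nhdsWithin)).exists
    exact hraise j haj hjr θ h3 (by linarith) (by linarith)
  -- At a tight price no buyers need to be added, so the whole segment could be raised (`θ = 1`).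
  have hnot_tight : ∀ j, a < j → j ≤ r → revenue v (y a) j ≠ revenue v (y a) a := by
    intro j haj hjr htight
    refine hraise j haj hjr 1 one_pos le_rfl ?_
    rw [← htight, revenue, mul_div_cancel_left₀ _ (hv_pos j).ne']
    linarith [h.sum_le j]
  refine ⟨y, a, h, m1 y₀ h₀, ?_, mem_Icc.mpr haℓ, fun k hk => ?_, fun i hi => ?_⟩
  · by_contra hcon
    have hlt : uniformRevenue v x < famPS v y := lt_of_le_of_ne h.rev_le (Ne.symm hcon)
    by_cases hall : ∀ t, a < t → revenue v (y a) t < revenue v (y a) a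
    · obtain ⟨y', h', h1, h2⟩ := h.exists_remove hv hv_pos ha hall hlt
      exact absurd h2 (not_lt.mpr (m2 y' h' h1.le))
    push Not at hall
    obtain ⟨T, haT, hT⟩ := hall
    have htight : revenue v (y a) T = revenue v (y a) a := le_antisymm (h.opt a T) hT
    have hrT : r < T := by
      by_contra hTr
      exact hnot_tight T haT (not_lt.mp hTr) htight
    -- A segment where `T` is not tight is active and differs from `a`, so its price exceeds `v a`
    -- and a swap would increase the correlation.
    have hallT : ∀ k, revenue v (y k) k ≤ revenue v (y k) T := by
      intro k
      by_contra hslack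
      have hslack := not_le.mp hslack
      have hak : a < k := by
        refine lt_of_le_of_ne (hmin k ?_) fun hak => ?_
        · exact (revenue_nonneg hv_pos (h.nonneg k) T).trans_lt hslack
        · subst hak; linarith
      obtain ⟨y', h', h1, h2, h3, h4⟩ := h.exists_swap hv hv_pos hak hrT ha htight hslack
      have := m4 y' h' h1.le h2.le (by rw [h3])
      linarith
    -- Since `T` is optimal in every segment at once, `PS` is the revenue of a single price on the
    -- served buyers.
    have hle : famPS v y ≤ revenue v x T := by
      calc famPS v y ≤ ∑ k, revenue v (y k) T := sum_le_sum fun k _ => hallT k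
        _ = revenue v (∑ k, y k) T := (revenue_sum _ _ _).symm
        _ ≤ revenue v x T := mul_le_mul_of_nonneg_left
            (demand_mono (fun i => by rw [Finset.sum_apply]; exact h.sum_le i) T) (hv_pos T).le
    linarith [revenue_le_uniformRevenue (v := v) x T]
  · exact h.eq_zero_of_revenue hv hv_pos fun hpos => not_lt.mpr (hmin k hpos) hk
  · rcases le_or_gt i r with hir | hir
    · exact hserved i hi hir
    · exact h.sum_eq i hir

end Extremal

/-! ### Valid schemes with one segment per price. -/

section Family

variable {n : ℕ} {v x : Fin n → ℝ} {F : Finset (Fin n)} {Y : Fin n → Fin n → ℝ}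

/-- An `F`-valid decomposition of the market `x` with one segment for each price. -/
structure IsFamily (v x : Fin n → ℝ) (F : Finset (Fin n)) (Y : Fin n → Fin n → ℝ) : Prop where
  nonneg : ∀ k i, 0 ≤ Y k i
  price_mem : ∀ k, k ∉ F → Y k = 0
  opt : ∀ k, IsOptPrice v (Y k) k
  sum_eq : ∀ i, ∑ k, Y k i = x i

/-- The segments of a market scheme, merged by price. -/
def MarketScheme.merge (Z : MarketScheme x) (k : Fin n) : Fin n → ℝ :=
  ∑ q with Z.price q = k, Z.seg q

/-- Optimality of a fixed price is preserved under sums, so nothing is lost by passing to this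
finite-dimensional form. -/
lemma MarketScheme.isFamily_merge {Z : MarketScheme x} (hZ : Z.IsValid v F) :
    IsFamily v x F Z.merge where
  nonneg k i := by
    rw [merge, Finset.sum_apply]
    exact sum_nonneg fun q _ => Z.seg_nonneg q i
  price_mem k hk := by
    rw [merge, filter_false_of_mem, sum_empty]
    rintro q - rfl
    exact hk (hZ q).1
  opt k := by
    refine IsOptPrice.sum fun q hq => ?_
    obtain rfl := (mem_filter.mp hq).2
    exact (hZ q).2
  sum_eq i := by
    simp only [merge, Finset.sum_apply]
    rw [sum_fiberwise, Z.sum_seg]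

lemma MarketScheme.famCS_merge (Z : MarketScheme x) : famCS v Z.merge = Z.CS v := by
  rw [CS, famCS, ← sum_fiberwise univ Z.price]
  refine sum_congr rfl fun k _ => ?_
  rw [merge, cs_sum]
  exact sum_congr rfl fun q hq => by rw [(mem_filter.mp hq).2]

/-- A decomposition indexed by prices is a market scheme. -/
lemma IsFamily.exists_scheme (hY : IsFamily v x F Y) {a : Fin n} (ha : a ∈ F) :
    ∃ Z : MarketScheme x, Z.IsValid v F ∧ Z.CS v = famCS v Y ∧ Z.PS v = famPS v Y ∧
      ∀ k ∈ F, ∀ i, ∑ q with Z.price q = k, Z.seg q i = Y k i := by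
  classical
  -- Segments with index outside `F` are empty, so they may be given the price `a` without effect.
  refine ⟨⟨n, Y, fun k => if k ∈ F then k else a, hY.nonneg, hY.sum_eq⟩, fun k => ?_, ?_, ?_,
    fun k hk i => ?_⟩
  · by_cases hk : k ∈ F
    · simpa [hk] using hY.opt k
    · simpa [hk, hY.price_mem k hk, ha] using isOptPrice_zero a
  · refine sum_congr rfl fun k _ => ?_
    by_cases hk : k ∈ F
    · simp [hk]
    · simp [hY.price_mem k hk]
  · refine sum_congr rfl fun k _ => ?_
    rw [ps_eq_revenue]
    by_cases hk : k ∈ F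
    · simp [hk]
    · simp [hY.price_mem k hk]
  · refine sum_eq_single_of_mem k (by simp [hk]) fun q hq hqk => ?_
    by_cases hqF : q ∈ F
    · simp [hqF, hqk] at hq
    · simp [hY.price_mem q hqF]

lemma IsFamily.revenue_le (hY : IsFamily v x F Y) (p : Fin n) : revenue v x p ≤ famPS v Y := by
  have : x = ∑ k, Y k := by
    funext i
    rw [Finset.sum_apply, hY.sum_eq]
  rw [this, revenue_sum]
  exact sum_le_sum fun k _ => hY.opt k p

/-- Dropping unserved buyers keeps each price optimal: demand becomes constant below the price and
is unchanged above it. -/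
lemma IsFamily.isServed (hv : StrictMono v) {ℓ r : Fin n} (hY : IsFamily v x (Icc ℓ r) Y) :
    IsServed v x ℓ r fun k => above k (Y k) where
  nonneg k i := above_nonneg (hY.nonneg k) k i
  price_mem k hk := by
    funext i
    simp [above, hY.price_mem k hk]
  supp k i hi := by simp [above, not_le.mpr hi]
  opt k t := by
    rw [revenue_above_self hv, revenue, demand_above hv]
    rcases le_total t k with h | h
    · rw [max_eq_right h]
      exact mul_le_mul_of_nonneg_right (hv.monotone h) (demand_nonneg (hY.nonneg k) k)
    · rw [max_eq_left h]
      exact hY.opt k t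
  sum_le i := by
    rw [← hY.sum_eq i]
    refine sum_le_sum fun k _ => ?_
    unfold above
    split_ifs
    · exact le_rfl
    · exact hY.nonneg k i
  sum_eq i hi := by
    rw [← hY.sum_eq i]
    refine sum_congr rfl fun k _ => ?_
    by_cases hk : k ∈ Icc ℓ r
    · simp [above, ((mem_Icc.mp hk).2.trans_lt hi).le]
    · simp [above, hY.price_mem k hk]
  rev_le := by
    have : Nonempty (Fin n) := ⟨r⟩
    simp only [revenue_above_self hv]
    exact uniformRevenue_le hY.revenue_le

lemma famCS_above (hv : StrictMono v) : famCS v (fun k => above k (Y k)) = famCS v Y := by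
  simp only [famCS, cs_above_self hv]

/-- The welfare of a family of segments all of whose prices are at least `v a`. -/
lemma famCS_add_famPS (hv : StrictMono v) {a : Fin n} (ha : ∀ k, k < a → Y k = 0) :
    famCS v Y + famPS v Y =
      v a * Y a a + ∑ i with a < i, v i * ∑ k ∈ Iic i, Y k i := by
  have h1 : famCS v Y + famPS v Y = ∑ i, v i * ∑ k ∈ Iic i, Y k i := by
    rw [famCS, famPS, ← sum_add_distrib]
    simp only [cs_add_revenue hv, mul_sum]
    refine sum_comm' fun k i => ?_
    simp
  have h2 : ∀ i, ∑ k ∈ Iic i, Y k i = ∑ k ∈ Icc a i, Y k i := by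
    intro i
    symm
    refine sum_subset (fun k hk => by simp_all) fun k hk hka => ?_
    rw [ha k (by simp_all), Pi.zero_apply]
  have h3 : ({i | a ≤ i} : Finset (Fin n)) = insert a ({i | a < i} : Finset (Fin n)) := by
    ext i
    simp [le_iff_eq_or_lt, eq_comm]
  rw [h1, ← sum_subset (subset_univ ({i | a ≤ i} : Finset (Fin n))), h3, sum_insert (by simp), h2 a,
    Icc_self, sum_singleton]
  intro i _ hi
  rw [h2, Icc_eq_empty (by simpa using hi), sum_empty, mul_zero]

lemma isCompact_isFamily : IsCompact {Y | IsFamily v x F Y} := by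
  refine (isCompact_Icc (a := (0 : Fin n → Fin n → ℝ)) (b := fun _ => x)).of_isClosed_subset
    ?_ ?_
  · have : {Y | IsFamily v x F Y} =
        {Y | ∀ k i, 0 ≤ Y k i} ∩ {Y | ∀ k, k ∉ F → Y k = 0} ∩
        {Y | ∀ k, IsOptPrice v (Y k) k} ∩ {Y | ∀ i, ∑ k, Y k i = x i} := by
      ext Y
      exact ⟨fun h => ⟨⟨⟨h.1, h.2⟩, h.3⟩, h.4⟩, fun ⟨⟨⟨h1, h2⟩, h3⟩, h4⟩ => ⟨h1, h2, h3, h4⟩⟩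
    rw [this]
    simp only [Set.ofPred_forall]
    refine (((?_ : IsClosed _).inter ?_).inter ?_).inter ?_
    · exact isClosed_iInter fun k => isClosed_iInter fun i =>
        isClosed_le (by fun_prop) (by fun_prop)
    · exact isClosed_iInter fun k => isClosed_iInter fun _ =>
        isClosed_eq (by fun_prop) (by fun_prop)
    · exact isClosed_iInter isClosed_isOptPrice
    · exact isClosed_iInter fun i => isClosed_eq (by fun_prop) (by fun_prop)
  · intro Y hY
    refine ⟨fun k i => hY.nonneg k i, fun k i => ?_⟩
    exact (single_le_sum (f := fun k => Y k i) (fun k _ => hY.nonneg k i) (mem_univ k)).trans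
      (hY.sum_eq i).le

end Family

/-! ### Putting unserved buyers back by water-filling. -/

section Completion

variable {n : ℕ} {v x : Fin n → ℝ}

/-- The market with a given cumulative demand. -/
noncomputable def ofDemand (H : Fin n → ℝ) (i : Fin n) : ℝ :=
  H i - if h : i.val + 1 < n then H ⟨i.val + 1, h⟩ else 0

lemma sum_Ici_eq (z : Fin n → ℝ) (p : Fin n) :
    ∑ i ∈ Ici p, z i =
      z p + if h : p.val + 1 < n then ∑ i ∈ Ici (⟨p.val + 1, h⟩ : Fin n), z i else 0 := by
  split_ifs with h
  · have : Ici p = insert p (Ici (⟨p.val + 1, h⟩ : Fin n)) := by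
      ext i
      simp only [mem_Ici, mem_insert, Fin.le_def, Fin.ext_iff]
      omega
    rw [this, sum_insert (by simp [Fin.le_def])]
  · have : Ici p = {p} := by
      ext i
      simp only [mem_Ici, mem_singleton, Fin.le_def, Fin.ext_iff]
      omega
    rw [this, sum_singleton, add_zero]

lemma ofDemand_demand (hv : StrictMono v) (z : Fin n → ℝ) : ofDemand (demand v z) = z := by
  funext i
  simp only [ofDemand, demand_eq hv]
  rw [sum_Ici_eq z i]
  ring

lemma demand_ofDemand (hv : StrictMono v) (H : Fin n → ℝ) (p : Fin n) :
    demand v (ofDemand H) p = H p := by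
  rw [demand_eq hv]
  induction hm : n - p.val using Nat.strong_induction_on generalizing p with
  | _ m ih =>
    rw [sum_Ici_eq, ofDemand]
    split_ifs with h
    · rw [ih (n - (p.val + 1)) (by omega) ⟨p.val + 1, h⟩ rfl]
      ring
    · ring

lemma ofDemand_nonneg {H : Fin n → ℝ} (hH : Antitone H) (h0 : ∀ i, 0 ≤ H i) (i : Fin n) :
    0 ≤ ofDemand H i := by
  rw [ofDemand, sub_nonneg]
  split_ifs with h
  · exact hH (by simp [Fin.le_def])
  · exact h0 i

lemma sum_ofDemand {ι : Type*} (s : Finset ι) (H : ι → Fin n → ℝ) (i : Fin n) :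
    ∑ k ∈ s, ofDemand (H k) i = ofDemand (fun t => ∑ k ∈ s, H k t) i := by
  simp only [ofDemand, sum_sub_distrib]
  split_ifs <;> simp

/-- The buyers that are not served can be distributed over the segments. -/
lemma IsServed.exists_family (hv : StrictMono v) (hv_pos : ∀ i, 0 < v i) {ℓ r a : Fin n}
    {y : Fin n → Fin n → ℝ} (h : IsServed v x ℓ r y) (hlow : ∀ k, k < a → y k = 0)
    (hhigh : ∀ i, a < i → ∑ k, y k i = x i) :
    ∃ Y, IsFamily v x (Icc a r) Y ∧ Y a a = y a a := by
  set R : Fin n → ℝ := fun k => revenue v (y k) k with hR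
  set E : Fin n → ℝ := fun k => demand v (y k) a with hE
  have hR0 : ∀ k, 0 ≤ R k := fun k => revenue_nonneg hv_pos (h.nonneg k) k
  have hE0 : ∀ k, 0 ≤ E k := fun k => demand_nonneg (h.nonneg k) a
  have hsumD : ∀ t, ∑ k, demand v (y k) t = demand v (∑ k, y k) t := fun t =>
    (demand_sum _ _ _).symm
  -- The level `c` at `t` comes from the intermediate value theorem. At `c = 0` the total is at most
  -- the demand of `x`; at `c = 1 / v t` it is large enough because total revenue is at least the
  -- uniform revenue.
  have hwater : ∀ t, ∃ c, 0 ≤ c ∧ c ≤ 1 / v t ∧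
      (t ≤ a → ∑ k, max (E k) (R k * c) = demand v x t) := by
    intro t
    have hvt : (0 : ℝ) ≤ 1 / v t := (one_div_pos.mpr (hv_pos t)).le
    by_cases ht : t ≤ a
    · have hc : Continuous fun c : ℝ => ∑ k, max (E k) (R k * c) := by fun_prop
      suffices hmem : demand v x t ∈ Set.Icc (∑ k, max (E k) (R k * 0))
          (∑ k, max (E k) (R k * (1 / v t))) by
        obtain ⟨c, hc1, hc2⟩ := intermediate_value_Icc hvt hc.continuousOn hmem
        exact ⟨c, hc1.1, hc1.2, fun _ => hc2⟩
      constructor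
      · calc ∑ k, max (E k) (R k * 0) = ∑ k, demand v (y k) a :=
              sum_congr rfl fun k _ => by rw [mul_zero, max_eq_left (hE0 k)]
          _ ≤ ∑ k, demand v (y k) t := sum_le_sum fun k _ => demand_antitone hv (h.nonneg k) ht
          _ ≤ demand v x t := by
              rw [hsumD]
              exact demand_mono (fun i => by rw [Finset.sum_apply]; exact h.sum_le i) t
      · calc demand v x t ≤ (∑ k, R k) * (1 / v t) := by
              rw [mul_one_div, le_div_iff₀ (hv_pos t), mul_comm]
              exact (revenue_le_uniformRevenue x t).trans h.rev_le
          _ = ∑ k, R k * (1 / v t) := sum_mul _ _ _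
          _ ≤ _ := sum_le_sum fun k _ => le_max_right _ _
    · exact ⟨0, le_rfl, hvt, fun h' => absurd h' ht⟩
  choose c hc0 hc1 hc using hwater
  -- Prescribed demand curves: unchanged above `a`; at or below `a`, filled to a level proportional
  -- to `R k` but never under the demand at `a`.
  set H : Fin n → Fin n → ℝ :=
    fun k t => if t ≤ a then max (E k) (R k * c t) else demand v (y k) t with hH
  have hH0 : ∀ k t, 0 ≤ H k t := by
    intro k t
    simp only [hH]
    split_ifs
    · exact (hE0 k).trans (le_max_left _ _)
    · exact demand_nonneg (h.nonneg k) t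
  have hanti : ∀ k, Antitone (H k) := by
    intro k t t' htt'
    simp only [hH]
    split_ifs with h1 h2 h2
    · rcases le_or_gt (c t') (c t) with hcc | hcc
      · exact max_le_max le_rfl (mul_le_mul_of_nonneg_left hcc (hR0 k))
      -- The levels need not be monotone, but where they rise with `t` the totals must agree, since
      -- demand of `x` falls; hence every summand agrees.
      · have hmono : ∀ l ∈ univ, max (E l) (R l * c t) ≤ max (E l) (R l * c t') := fun l _ =>
          max_le_max le_rfl (mul_le_mul_of_nonneg_left hcc.le (hR0 l))
        have hD := demand_antitone hv (v := v) (x := x) (fun i =>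
          (sum_nonneg fun k _ => h.nonneg k i).trans (h.sum_le i)) htt'
        rw [← hc t h2, ← hc t' h1] at hD
        exact ((sum_eq_sum_iff_of_le hmono).mp (le_antisymm (sum_le_sum hmono) hD) k
          (mem_univ k)).ge
    · exact absurd (htt'.trans h1) h2
    · exact (demand_antitone hv (h.nonneg k) (not_le.mp h1).le).trans (le_max_left _ _)
    · exact demand_antitone hv (h.nonneg k) htt'
  -- The bound `c t ≤ 1 / v t` is exactly what keeps the revenue at `t` below `R k`.
  have hcap : ∀ k t, v t * H k t ≤ R k := by
    intro k t
    simp only [hH]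
    split_ifs with ht
    · rw [mul_max_of_nonneg _ _ (hv_pos t).le, max_le_iff]
      constructor
      · exact (mul_le_mul_of_nonneg_right (hv.monotone ht) (hE0 k)).trans (h.opt k a)
      · have := mul_le_mul_of_nonneg_left (hc1 t) (hR0 k)
        rw [mul_one_div, le_div_iff₀ (hv_pos t)] at this
        linarith
    · exact h.opt k t
  have hself : ∀ k, v k * H k k = R k := by
    intro k
    rcases lt_trichotomy k a with hk | rfl | hk
    · have hRk : R k = 0 := by simp [hR, hlow k hk]
      have hEk : E k = 0 := by simp [hE, hlow k hk]
      simp [hH, hk.le, hRk, hEk]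
    · refine le_antisymm (hcap k k) ?_
      refine mul_le_mul_of_nonneg_left ?_ (hv_pos k).le
      simp only [hH, le_refl, if_true]
      exact le_max_left _ _
    · simp [hH, not_le.mpr hk, hR, revenue]
  have hsum : ∀ t, ∑ k, H k t = demand v x t := by
    intro t
    by_cases ht : t ≤ a
    · simp only [hH, ht, if_true]
      exact hc t ht
    · simp only [hH, ht, if_false]
      rw [hsumD, demand_eq hv, demand_eq hv]
      refine sum_congr rfl fun i hi => ?_
      rw [Finset.sum_apply]
      exact hhigh i ((not_le.mp ht).trans_le (mem_Ici.mp hi))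
  refine ⟨fun k => ofDemand (H k), ⟨fun k => ofDemand_nonneg (hanti k) (hH0 k), ?_, ?_, ?_⟩, ?_⟩
  · intro k hk
    have hyk : y k = 0 := by
      by_cases hka : k < a
      · exact hlow k hka
      · refine h.price_mem k fun hk' => hk ?_
        exact mem_Icc.mpr ⟨not_lt.mp hka, (mem_Icc.mp hk').2⟩
    have : H k = 0 := by
      funext t
      simp [hH, hE, hR, hyk]
    funext i
    simp [this, ofDemand]
  · intro k t
    rw [revenue, revenue, demand_ofDemand hv, demand_ofDemand hv, hself]
    exact hcap k t
  · intro i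
    rw [sum_ofDemand, funext hsum, ofDemand_demand hv]
  · have hHa : H a a = demand v (y a) a :=
      mul_left_cancel₀ (hv_pos a).ne' (hself a)
    conv_rhs => rw [← ofDemand_demand hv (y a)]
    -- The mass at `a` is the demand drop from `a` to `a + 1`, and the new curve agrees with the old
    -- one at both.
    have hnext : ∀ hn : a.val + 1 < n, H a ⟨a.val + 1, hn⟩ = demand v (y a) ⟨a.val + 1, hn⟩ :=
      fun hn => if_neg (by simp [Fin.le_def])
    simp only [ofDemand, hHa, hnext]

end Completion

/-! ### The lower bound and the attainment of the minimal mass. -/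

section Main

variable {n : ℕ} {v x : Fin n → ℝ} {ℓ r : Fin n}

/-- Every valid market scheme has at least the consumer surplus of a market scheme that serves
exactly the buyers of the highest values and has minimal producer surplus. -/
lemma exists_isSubFeasible_le_CS (hv : StrictMono v) (hv_pos : ∀ i, 0 < v i) (hx : ∀ i, 0 ≤ x i)
    (hℓr : ℓ ≤ r) {Z : MarketScheme x} (hZ : Z.IsValid v (Icc ℓ r)) :
    ∃ a ∈ Icc ℓ r, ∃ η, 0 ≤ η ∧ η ≤ x a ∧ IsSubFeasible v x ℓ r a η ∧
      IsFeasible v x (Icc a r) ∧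
      η * v a + (∑ j with a < j, x j * v j) - uniformRevenue v x ≤ Z.CS v := by
  obtain ⟨y, a, h, hcs, hps, ha, hlow, hhigh⟩ :=
    ((Z.isFamily_merge hZ).isServed hv).exists_top hv hv_pos hx hℓr
  rw [famCS_above hv, Z.famCS_merge] at hcs
  obtain ⟨Y, hY, hYa⟩ := h.exists_family hv hv_pos hlow hhigh
  have hmem := mem_Icc.mp ha
  have haa : a ∈ Icc a r := left_mem_Icc.mpr hmem.2
  obtain ⟨Z', hZ', -, -, hseg⟩ := hY.exists_scheme haa
  refine ⟨a, ha, y a a, h.nonneg a a, ?_, ⟨Z', ?_, fun q => (hZ' q).1, ?_⟩, ⟨Z', hZ'⟩, ?_⟩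
  · exact (single_le_sum (f := fun k => y k a) (fun k _ => h.nonneg k a) (mem_univ a)).trans
      (h.sum_le a)
  · exact fun q => ⟨Icc_subset_Icc_left hmem.1 (hZ' q).1, (hZ' q).2⟩
  · rw [hseg a haa, hYa]
  · have hw := famCS_add_famPS hv hlow
    -- Served buyers of value `v i` pay at most `v i`, and for `i > a` they are all the buyers of
    -- that value.
    have hsum : ∑ i with a < i, v i * ∑ k ∈ Iic i, y k i = ∑ j with a < j, x j * v j := by
      refine sum_congr rfl fun i hi => ?_
      rw [sum_subset (subset_univ (Iic i)) fun k _ hk => h.supp k i (by simpa using hk),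
        hhigh i (mem_filter.mp hi).2, mul_comm]
    rw [hsum, hps] at hw
    linarith [mul_comm (v a) (y a a)]

/-- The minimal mass is attained. -/
lemma exists_isFamily_minimalMass {i : Fin n} (hℓi : ℓ ≤ i) (hir : i ≤ r)
    (hF : IsFeasible v x (Icc i r)) :
    ∃ Y, IsFamily v x (Icc i r) Y ∧
      IsLeast {η : ℝ | 0 ≤ η ∧ η ≤ x i ∧ IsSubFeasible v x ℓ r i η} (Y i i) := by
  -- Merging by price turns the infimum over schemes of arbitrary size into a minimum over a compact
  -- set.
  obtain ⟨Z, hZ⟩ := hF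
  obtain ⟨Y, hY, hmin⟩ := (isCompact_isFamily (v := v) (x := x) (F := Icc i r)).exists_isMinOn
    ⟨Z.merge, Z.isFamily_merge hZ⟩ (f := fun Y => Y i i) (by fun_prop)
  have hi : i ∈ Icc i r := left_mem_Icc.mpr hir
  obtain ⟨Z', hZ', -, -, hseg⟩ := IsFamily.exists_scheme hY hi
  refine ⟨Y, hY, ⟨hY.nonneg i i, ?_, Z', ?_, fun q => (hZ' q).1, (hseg i hi i).le⟩, ?_⟩
  · exact (single_le_sum (f := fun k => Y k i) (fun k _ => hY.nonneg k i) (mem_univ i)).trans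
      (hY.sum_eq i).le
  · exact fun q => ⟨Icc_subset_Icc_left hℓi (hZ' q).1, (hZ' q).2⟩
  · rintro η ⟨-, -, W, hW, hprice, hη⟩
    have hWF : IsFamily v x (Icc i r) W.merge :=
      W.isFamily_merge fun q => ⟨hprice q, (hW q).2⟩
    refine (hmin hWF).trans ?_
    simpa only [MarketScheme.merge, Finset.sum_apply] using hη

end Main

end PriceRegulation

open PriceRegulation in
theorem mainTheorem4 {n : ℕ} (v : Fin n → ℝ) (hv : StrictMono v) (hv_pos : ∀ i, 0 < v i)
    (xstar : Fin n → ℝ) (hx : ∀ i, 0 ≤ xstar i)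
    (ℓ r : Fin n) (hℓr : ℓ ≤ r)
    (hF : PriceRegulation.IsFeasible v xstar (Finset.Icc ℓ r)) :
    IsLeast (PriceRegulation.achievableCS v xstar (Finset.Icc ℓ r))
      (PriceRegulation.minCS v xstar (Finset.Icc ℓ r)) ∧
    (∃ Z : PriceRegulation.MarketScheme xstar, Z.IsValid v (Finset.Icc ℓ r) ∧
      Z.CS v = PriceRegulation.minCS v xstar (Finset.Icc ℓ r) ∧
      Z.PS v = PriceRegulation.uniformRevenue v xstar) ∧
    PriceRegulation.minCS v xstar (Finset.Icc ℓ r) =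
      PriceRegulation.minimalMass v xstar ℓ r (PriceRegulation.minimalIndex v xstar ℓ r hℓr hF) *
          v (PriceRegulation.minimalIndex v xstar ℓ r hℓr hF) +
        (∑ j with PriceRegulation.minimalIndex v xstar ℓ r hℓr hF < j, xstar j * v j) -
        PriceRegulation.uniformRevenue v xstar := by
  classical
  obtain ⟨i, hi⟩ : ∃ i, i = minimalIndex v xstar ℓ r hℓr hF := ⟨_, rfl⟩
  have hi_mem : i ∈ ({i ∈ Finset.Icc ℓ r | IsFeasible v xstar (Finset.Icc i r)} :
      Finset (Fin n)) := by
    rw [hi]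
    exact Finset.max'_mem _ _
  have hi_max : ∀ a ∈ Finset.Icc ℓ r, IsFeasible v xstar (Finset.Icc a r) → a ≤ i := by
    intro a ha haF
    rw [hi, minimalIndex]
    exact Finset.le_max' _ _ (Finset.mem_filter.mpr ⟨ha, haF⟩)
  rw [← hi]
  obtain ⟨hi_Icc, hi_feas⟩ := Finset.mem_filter.mp hi_mem
  obtain ⟨hℓi, hir⟩ := Finset.mem_Icc.mp hi_Icc
  obtain ⟨Y, hY, hleast⟩ := exists_isFamily_minimalMass hℓi hir hi_feas
  have hmass : minimalMass v xstar ℓ r i = Y i i := hleast.csInf_eq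
  obtain ⟨Z, hZ, hZcs, hZps, -⟩ := hY.exists_scheme (Finset.left_mem_Icc.mpr hir)
  have hZ' : Z.IsValid v (Finset.Icc ℓ r) := fun q =>
    ⟨Finset.Icc_subset_Icc_left hℓi (hZ q).1, (hZ q).2⟩
  rw [hmass]
  have hlower : ∀ c ∈ achievableCS v xstar (Finset.Icc ℓ r),
      Y i i * v i + (∑ j with i < j, xstar j * v j) - uniformRevenue v xstar ≤ c := by
    rintro _ ⟨W, hW, rfl⟩
    obtain ⟨a, ha, η, hη0, hηx, hsub, hfeas, hle⟩ :=
      exists_isSubFeasible_le_CS hv hv_pos hx hℓr hW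
    refine le_trans (sub_le_sub_right ?_ _) hle
    -- For `a = i` minimality of the mass decides. For `a < i` the sum over `j > a` already contains
    -- the full term `xstar i * v i`, which dominates `Y i i * v i`.
    rcases (hi_max a ha hfeas).eq_or_lt with rfl | hai
    · gcongr
      · exact (hv_pos a).le
      · exact hleast.2 ⟨hη0, hηx, hsub⟩
    · have hYi : Y i i * v i ≤ xstar i * v i :=
        mul_le_mul_of_nonneg_right hleast.1.2.1 (hv_pos i).le
      have hsum : xstar i * v i + (∑ j with i < j, xstar j * v j) ≤
          ∑ j with a < j, xstar j * v j := by
        rw [← Finset.sum_insert (f := fun j => xstar j * v j) (by simp)]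
        refine Finset.sum_le_sum_of_subset_of_nonneg (fun j hj => ?_) fun j _ _ =>
          mul_nonneg (hx j) (hv_pos j).le
        rcases Finset.mem_insert.mp hj with rfl | hj
        · simpa using hai
        · simpa using hai.trans (Finset.mem_filter.mp hj).2
      have := mul_nonneg hη0 (hv_pos a).le
      linarith
  have hps_ge : uniformRevenue v xstar ≤ famPS v Y := by
    have : Nonempty (Fin n) := ⟨r⟩
    exact uniformRevenue_le hY.revenue_le
  have hwelfare : famCS v Y + famPS v Y ≤ Y i i * v i + ∑ j with i < j, xstar j * v j := by
    rw [famCS_add_famPS hv (a := i) fun k hk =>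
      hY.price_mem k fun hk' => not_lt.mpr (Finset.mem_Icc.mp hk').1 hk, mul_comm]
    refine add_le_add le_rfl (Finset.sum_le_sum fun j _ => ?_)
    rw [mul_comm]
    refine mul_le_mul_of_nonneg_right ?_ (hv_pos j).le
    rw [← hY.sum_eq j]
    exact Finset.sum_le_sum_of_subset_of_nonneg (Finset.subset_univ _) fun k _ _ => hY.nonneg k j
  have hZach : Z.CS v ∈ achievableCS v xstar (Finset.Icc ℓ r) := ⟨Z, hZ', rfl⟩
  have hZle := hlower _ hZach
  rw [hZcs] at hZle
  -- Welfare is bounded above, `PS` and `CS` below, by quantities that add up exactly, so all three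
  -- bounds are equalities.
  have hcs : Z.CS v =
      Y i i * v i + (∑ j with i < j, xstar j * v j) - uniformRevenue v xstar := by
    rw [hZcs]
    linarith
  have hisLeast : IsLeast (achievableCS v xstar (Finset.Icc ℓ r)) (Z.CS v) :=
    ⟨hZach, fun c hc => hcs.trans_le (hlower c hc)⟩
  have hmin : minCS v xstar (Finset.Icc ℓ r) = Z.CS v := hisLeast.csInf_eq
  rw [hmin]
  refine ⟨hisLeast, ⟨Z, hZ', rfl, ?_⟩, hcs⟩
  rw [hZps]
  linarith
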